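/- Fix a dimension $n\ge 1$, a dataset size $N\ge 0$, a sampling ratio $q\in[0,1]$ and a noise multiplier $\sigma>0$. For probability distributions $P,Q$ on the same space, the trade-off function $T(P,Q)(\alpha)$, $\alpha\in[0,1]$, is the infimum of the type II errors $\mathbb E_Q[1-\phi]$ over all measurable rejection rules $\phi$ with values in $[0,1]$ and $\mathbb E_P[\phi]\le\alpha$. Write $\mathrm{ID}(\alpha)=1-\alpha$ and $G_\mu=T(\mathcal N(0,1),\mathcal N(\mu,1))$. **Mechanism.** Let $g$ assign a vector $g(d)\in\mathbb R^n$ to every data point $d$, let $C>0$, and put $\bar g_i=g(d_i)/\max(1,\|g(d_i)\|_2/C)$. On a dataset $D=(d_1,\dots,d_N)$ the batch-averaged subsampled Gaussian mechanism (ASGM) $\mathcal M$ draws a batch $B\subseteq\{1,\dots,N\}$ with probability $P(B)=q^{|B|}(1-q)^{N-|B|}$, draws $G\sim\mathcal N(0,\sigma^2C^2\mathbb I)$ on $\mathbb R^n$ independently of $B$, and outputs $\bigl(\sum_{i\in B}\bar g_i+G\bigr)/\max(|B|,1)$. **Components.** Let $P=\mathcal N(0,1)$ and, for nonempty $B$,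 let $Q_B^{\mu}=\mathcal N\bigl(\mu,(|B|/(|B|+1))^2\bigr)$, $Q_B=Q_B^0$ and $\overline\mu_B=\frac{2|B|}{(|B|+1)\sigma}$. Put $$\underline f_B^1=\mathrm{ID}=T(P^{\otimes n},P^{\otimes n}),\quad \underline f_B^2=T\bigl(P^{\otimes n},Q_B^{\otimes(n-1)}\otimes Q_B^{\overline\mu_B}\bigr)\quad(B\ne\emptyset),$$ $$\underline f_\emptyset^1=\mathrm{ID}=T(P,P),\quad \underline f_\emptyset^2=G_{1/\sigma}=T(P,\mathcal N(1/\sigma,1)).$$ For $t\in[0,\infty]$ and $c\in[0,1]$, let $\alpha_B^j(t,c)$ be the type I error of the likelihood-ratio test with threshold $t$ and tie probability $c$ for the pair defining $\underline f_B^j$; that is, for a pair $(P',Q')$ with densities $p',q'$ it is $\Pr_{x\sim P'}[q'(x)/p'(x)>t]+c\Pr_{x\sim P'}[q'(x)/p'(x)=t]$. Let $$\alpha(t,c)=\sum_{B\subseteq\{1,\dots,N\}}P(B)\bigl[(1-q)\,\alpha_B^1(t,c)+q\,\alpha_B^2(t,c)\bigr].$$ **Theorem.** The values $\alpha(t,c)$,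 $t\in[0,\infty]$, $c\in[0,1]$, fill exactly $[0,1]$, and there is a (hence unique) trade-off function $\underline f$ on $[0,1]$, depending only on $n,N,q,\sigma$, such that for all $t\in[0,\infty]$ and $c\in[0,1]$ $$\underline f(\alpha(t,c))=\sum_{\emptyset\ne B\subseteq\{1,\dots,N\}}P(B)\bigl[(1-q)\underline f_B^1(\alpha_B^1(t,c))+q\,\underline f_B^2(\alpha_B^2(t,c))\bigr]+(1-q)^N\bigl[(1-q)\underline f_\emptyset^1(\alpha_\emptyset^1(t,c))+q\,\underline f_\emptyset^2(\alpha_\emptyset^2(t,c))\bigr].$$ It is a privacy guarantee for ASGM: for all $g$, all $C>0$ and every neighbouring pair $D=(d_1,\dots,d_N)$, $D'=(d_1,\dots,d_N,d_{N+1})$, $$T\bigl(\mathcal M(D),\mathcal M(D')\bigr)(\alpha)\ \ge\ \underline f(\alpha)\qquad\text{for all }\alpha\in[0,1].$$ -/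

import Mathlib

open MeasureTheory ProbabilityTheory
open scoped ENNReal NNReal

noncomputable section

namespace ASGM

/-! ### Hypothesis testing: trade-off functions and likelihood-ratio tests -/

/-- A (possibly randomized) rejection rule: `φ x` is the probability of rejecting `H₀` when the
observation is `x`. -/
def IsRejectionRule {Ω : Type*} [MeasurableSpace Ω] (φ : Ω → ℝ) : Prop :=
  Measurable φ ∧ ∀ x, 0 ≤ φ x ∧ φ x ≤ 1

/-- The trade-off function `T(P, Q)(α)`: the infimum of the type II errors `E_Q[1 - φ]` over all
rejection rules `φ` whose type I error `E_P[φ]` is at most `α` (meaningful for `α ≥ 0`). -/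
def tradeOff {Ω : Type*} [MeasurableSpace Ω] (P Q : Measure Ω) (α : ℝ) : ℝ :=
  sInf {β : ℝ | ∃ φ : Ω → ℝ, IsRejectionRule φ ∧ ∫ x, φ x ∂P ≤ α ∧ β = ∫ x, (1 - φ x) ∂Q}

/-- `f` is a trade-off function (on `[0, 1]`): it equals `T(P, Q)` for some pair of probability
distributions. -/
def IsTradeOffFunction (f : ℝ → ℝ) : Prop :=
  ∃ (Ω : Type) (_ : MeasurableSpace Ω) (P Q : Measure Ω),
    IsProbabilityMeasure P ∧ IsProbabilityMeasure Q ∧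
      ∀ α ∈ Set.Icc (0 : ℝ) 1, f α = tradeOff P Q α

/-- The type I error `P[q/p > t] + c * P[q/p = t]` of the likelihood-ratio test of `P` against `Q`
with threshold `t ∈ [0, ∞]` that rejects with probability `c` on ties. Under `P`, the likelihood
ratio `q/p` is the Radon-Nikodym derivative `dQ/dP`. -/
def lrtTypeI {Ω : Type*} [MeasurableSpace Ω] (P Q : Measure Ω) (t : ℝ≥0∞) (c : ℝ) : ℝ :=
  P.real {x | t < Q.rnDeriv P x} + c * P.real {x | Q.rnDeriv P x = t}

/-- The trade-off function `ID(α) = 1 - α` of two identical distributions. -/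
def idTradeOff (α : ℝ) : ℝ := 1 - α

/-- The Gaussian trade-off function `G_μ = T(N(0, 1), N(μ, 1))`. -/
def gaussianTradeOff (μ : ℝ) (α : ℝ) : ℝ :=
  tradeOff (gaussianReal 0 1) (gaussianReal μ 1) α

/-! ### The batch-averaged subsampled Gaussian mechanism -/

/-- Clipping to norm at most `C`: `g / max (1, ‖g‖ / C)`. -/
def clip {n : ℕ} (C : ℝ) (g : EuclideanSpace ℝ (Fin n)) : EuclideanSpace ℝ (Fin n) :=
  (max 1 (‖g‖ / C))⁻¹ • g

/-- The probability that Poisson sampling with ratio `q` from `N` points selects the batch `B`. -/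
def batchProb {N : ℕ} (q : ℝ) (B : Finset (Fin N)) : ℝ :=
  q ^ B.card * (1 - q) ^ (N - B.card)

/-- The isotropic Gaussian `N(0, σ² C² I)` on `ℝⁿ`. -/
def noise (n : ℕ) (σ C : ℝ) : Measure (EuclideanSpace ℝ (Fin n)) :=
  (stdGaussian (EuclideanSpace ℝ (Fin n))).map (fun z => (σ * C) • z)

/-- The normalization factor: the batch size, replaced by `1` for the empty batch. -/
def normFactor {N : ℕ} (B : Finset (Fin N)) : ℝ :=
  if B = ∅ then 1 else (B.card : ℝ)

/-- The output distribution of the batch-averaged subsampled Gaussian mechanism on the dataset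
`D = (d₁, …, d_N)`, where `g` computes the information vector of a data point: a batch `B` is drawn
by Poisson sampling, and the output is `(∑_{i ∈ B} clip (g dᵢ) + G) / |B|`, `G ~ N(0, σ² C² I)`. -/
def asgm {X : Type*} {n N : ℕ} (g : X → EuclideanSpace ℝ (Fin n)) (q σ C : ℝ) (D : Fin N → X) :
    Measure (EuclideanSpace ℝ (Fin n)) :=
  ∑ B : Finset (Fin N), ENNReal.ofReal (batchProb q B) •
    (noise n σ C).map (fun z => (normFactor B)⁻¹ • ((∑ i ∈ B, clip C (g (D i))) + z))

/-! ### The explicit lower bound -/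

/-- `P^{⊗ n}` with `P = N(0, 1)`. -/
def nullLaw (n : ℕ) : Measure (Fin n → ℝ) :=
  Measure.pi fun _ => gaussianReal 0 1

/-- `Q_b^{⊗ (n-1)} ⊗ Q_b^μ` with `Q_b^μ = N(μ, (b / (b+1))²)` and `Q_b = Q_b^0`; the last coordinate
is the one with mean `μ`. -/
def altLaw (n b : ℕ) (μ : ℝ) : Measure (Fin n → ℝ) :=
  Measure.pi fun i => gaussianReal (if (i : ℕ) + 1 = n then μ else 0) (((b : ℝ≥0) / (b + 1)) ^ 2)

/-- `μ̄_B = 2 |B| / ((|B| + 1) σ)` for a batch of size `b`. -/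
def muBar (σ : ℝ) (b : ℕ) : ℝ := 2 * b / ((b + 1) * σ)

/-- The type I error `α(t, c)`: the mixture of the type I errors of the componentwise
likelihood-ratio tests, with common threshold `t` and tie probability `c`. -/
def lowerAlpha (n N : ℕ) (q σ : ℝ) (t : ℝ≥0∞) (c : ℝ) : ℝ :=
  (∑ B : Finset (Fin N) with B ≠ ∅, batchProb q B *
      ((1 - q) * lrtTypeI (nullLaw n) (nullLaw n) t c
        + q * lrtTypeI (nullLaw n) (altLaw n B.card (muBar σ B.card)) t c))
    + (1 - q) ^ N *
      ((1 - q) * lrtTypeI (gaussianReal 0 1) (gaussianReal 0 1) t c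
        + q * lrtTypeI (gaussianReal 0 1) (gaussianReal (1 / σ) 1) t c)

/-- The value at `α(t, c)` of the lower bound: the mixture of the component trade-off functions,
each evaluated at the type I error of its own likelihood-ratio test. -/
def lowerValue (n N : ℕ) (q σ : ℝ) (t : ℝ≥0∞) (c : ℝ) : ℝ :=
  (∑ B : Finset (Fin N) with B ≠ ∅, batchProb q B *
      ((1 - q) * idTradeOff (lrtTypeI (nullLaw n) (nullLaw n) t c)
        + q * tradeOff (nullLaw n) (altLaw n B.card (muBar σ B.card))
            (lrtTypeI (nullLaw n) (altLaw n B.card (muBar σ B.card)) t c)))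
    + (1 - q) ^ N *
      ((1 - q) * idTradeOff (lrtTypeI (gaussianReal 0 1) (gaussianReal 0 1) t c)
        + q * gaussianTradeOff (1 / σ)
            (lrtTypeI (gaussianReal 0 1) (gaussianReal (1 / σ) 1) t c))

end ASGM

end

/-!
The bound `f` is the trade-off function of one explicit pair of laws. Index the components by a batch
`B` of the smaller dataset together with the decision whether the additional point is sampled, and
let the null law and the alternative be the mixtures of the component laws `compNull` and `compAlt`
in which the index is observed along with the sample (`taggedMixture`). Both mixtures have the same
weights, so their likelihood ratio at `(i, x)` is that of the `i`-th component at `x`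
(`taggedMixture_withDensity`). Hence the likelihood-ratio test of the mixtures with threshold `t` and
tie probability `c` runs the test with the same `t` and `c` in every component, and its errors are
the weighted sums `lowerAlpha` and `lowerValue`. By the Neyman-Pearson lemma
(`integral_le_integral_lrt`) it is optimal at its level, and every level occurs
(`exists_integral_lrt_eq`).

For the privacy guarantee, the two output laws are mixtures with the same weights of the output laws
for a fixed batch (`asgm_eq_sum`, `asgm_snoc_eq_sum`). It suffices that each component of the bound is
at least as easy to test as the corresponding pair of output laws, in the sense of `TestDominates`,
because tests chosen componentwise assemble to a test of the tagged mixtures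
(`testDominates_taggedMixture`).

If the additional point is not sampled, both laws agree. If it is added to the empty batch, the laws
are `N(0, I)` and `N(m, I)` with `‖m‖ ≤ 1 / σ` after rescaling; optimal tests reject in half-spaces,
and the problem reduces to the line (`testDominates_gaussianReal`). If it is added to a batch of size
`b ≥ 1`, rescaling leads to `N(0, I)` and `N(m, s² I)` with `s = b / (b + 1) < 1` and
`‖m‖ ≤ 2 b / ((b + 1) σ)`. Since `s < 1`, the optimal tests reject in balls. When `m` is replaced by a
longer vector, a ball at the same distance from the new mean, but further away from the origin, has
the same power and a smaller level (`testDominates_isoGaussian`); the latter is the monotonicity of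
the Gaussian mass of balls, proved by a reflection (`integral_antitone_norm_sub_le`).
-/

noncomputable section

namespace ASGM

/-! ### Likelihood-ratio tests and the Neyman-Pearson lemma -/

section NeymanPearson

variable {Ω : Type*} [MeasurableSpace Ω]

lemma IsRejectionRule.integrable {φ : Ω → ℝ} (hφ : IsRejectionRule φ) (P : Measure Ω)
    [IsFiniteMeasure P] : Integrable φ P :=
  Integrable.of_bound hφ.1.aestronglyMeasurable 1
    (Filter.Eventually.of_forall fun x => by
      rw [Real.norm_eq_abs, abs_of_nonneg (hφ.2 x).1]; exact (hφ.2 x).2)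

lemma IsRejectionRule.comp {Ω' : Type*} [MeasurableSpace Ω'] {φ : Ω' → ℝ} (hφ : IsRejectionRule φ)
    {f : Ω → Ω'} (hf : Measurable f) : IsRejectionRule (φ ∘ f) :=
  ⟨hφ.1.comp hf, fun x => hφ.2 (f x)⟩

lemma IsRejectionRule.integral_nonneg {φ : Ω → ℝ} (hφ : IsRejectionRule φ) (P : Measure Ω) :
    0 ≤ ∫ x, φ x ∂P :=
  MeasureTheory.integral_nonneg fun x => (hφ.2 x).1

lemma IsRejectionRule.integral_le_one {φ : Ω → ℝ} (hφ : IsRejectionRule φ) (P : Measure Ω)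
    [IsProbabilityMeasure P] : ∫ x, φ x ∂P ≤ 1 := by
  simpa using integral_mono (hφ.integrable P) (integrable_const (1 : ℝ)) fun x => (hφ.2 x).2

lemma IsRejectionRule.integral_one_sub {φ : Ω → ℝ} (hφ : IsRejectionRule φ) (P : Measure Ω)
    [IsProbabilityMeasure P] : ∫ x, (1 - φ x) ∂P = 1 - ∫ x, φ x ∂P := by
  rw [integral_sub (integrable_const _) (hφ.integrable P)]
  simp

lemma isRejectionRule_const {c : ℝ} (hc : c ∈ Set.Icc (0 : ℝ) 1) :
    IsRejectionRule fun _ : Ω => c :=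
  ⟨measurable_const, fun _ => hc⟩

/-- The likelihood-ratio test for the likelihood ratio `L`: reject above the threshold `t`, and
with probability `c` at the threshold. -/
def lrt (L : Ω → ℝ≥0∞) (t : ℝ≥0∞) (c : ℝ) (x : Ω) : ℝ :=
  if t < L x then 1 else if L x = t then c else 0

lemma isRejectionRule_lrt {L : Ω → ℝ≥0∞} (hL : Measurable L) (t : ℝ≥0∞) {c : ℝ}
    (hc : c ∈ Set.Icc (0 : ℝ) 1) : IsRejectionRule (lrt L t c) := by
  refine ⟨Measurable.ite (measurableSet_lt measurable_const hL) measurable_const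
    (Measurable.ite (measurableSet_eq_fun hL measurable_const) measurable_const
      measurable_const), fun x => ?_⟩
  unfold lrt
  split_ifs
  · simp
  · exact hc
  · simp

lemma integral_lrt {L : Ω → ℝ≥0∞} (hL : Measurable L) (P : Measure Ω) [IsFiniteMeasure P]
    (t : ℝ≥0∞) (c : ℝ) :
    ∫ x, lrt L t c x ∂P = P.real {x | t < L x} + c * P.real {x | L x = t} := by
  have h1 : MeasurableSet {x | t < L x} := measurableSet_lt measurable_const hL
  have h2 : MeasurableSet {x | L x = t} := measurableSet_eq_fun hL measurable_const
  have h : lrt L t c = fun x => {x | t < L x}.indicator (fun _ => (1 : ℝ)) x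
      + {x | L x = t}.indicator (fun _ => c) x := by
    ext x
    by_cases hx : t < L x
    · simp [lrt, hx, hx.ne']
    · simp [lrt, hx, Set.indicator_apply]
  rw [h, integral_add ((integrable_const _).indicator h1) ((integrable_const _).indicator h2),
    integral_indicator_const _ h1, integral_indicator_const _ h2]
  simp [mul_comm]

lemma integral_lrt_rnDeriv (P Q : Measure Ω) [IsFiniteMeasure P] (t : ℝ≥0∞) (c : ℝ) :
    ∫ x, lrt (Q.rnDeriv P) t c x ∂P = lrtTypeI P Q t c :=
  integral_lrt (Measure.measurable_rnDeriv Q P) P t c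

lemma ae_lt_top_of_withDensity {L : Ω → ℝ≥0∞} (hL : Measurable L) (P : Measure Ω)
    [IsFiniteMeasure (P.withDensity L)] : ∀ᵐ x ∂P, L x < ∞ := by
  refine ae_lt_top hL ?_
  rw [← setLIntegral_univ, ← withDensity_apply _ MeasurableSet.univ]
  exact measure_ne_top _ _

/-- The Neyman-Pearson lemma: the likelihood-ratio test is most powerful at its own level. -/
lemma integral_le_integral_lrt {L : Ω → ℝ≥0∞} (hL : Measurable L) (P : Measure Ω)
    [IsProbabilityMeasure P] [IsFiniteMeasure (P.withDensity L)] (t : ℝ≥0∞) {c : ℝ}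
    (hc : c ∈ Set.Icc (0 : ℝ) 1) {ψ : Ω → ℝ} (hψ : IsRejectionRule ψ)
    (h : ∫ x, ψ x ∂P ≤ ∫ x, lrt L t c x ∂P) :
    ∫ x, ψ x ∂(P.withDensity L) ≤ ∫ x, lrt L t c x ∂(P.withDensity L) := by
  have hφ := isRejectionRule_lrt hL t hc
  have hfin := ae_lt_top_of_withDensity hL P
  rcases eq_or_ne t ∞ with rfl | ht
  · -- at threshold `∞` the level is `0`, and every test of level `0` is trivial
    have h0 : ∫ x, lrt L ∞ c x ∂P = 0 := by
      refine integral_eq_zero_of_ae ?_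
      filter_upwards [hfin] with x hx
      simp [lrt, hx.ne]
    have h1 : ∫ x, ψ x ∂P = 0 := le_antisymm (h.trans h0.le) (hψ.integral_nonneg P)
    rw [integral_eq_zero_iff_of_nonneg (fun x => (hψ.2 x).1) (hψ.integrable P)] at h1
    rw [integral_eq_zero_of_ae ((withDensity_absolutelyContinuous P L).ae_eq h1)]
    exact hφ.integral_nonneg _
  · have key : 0 ≤ ∫ x, (lrt L t c x - ψ x) * ((L x).toReal - t.toReal) ∂P := by
      refine integral_nonneg_of_ae ?_
      filter_upwards [hfin] with x hx
      have := hψ.2 x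
      simp only [lrt, Pi.zero_apply]
      split_ifs with h1 h2
      · have : t.toReal ≤ (L x).toReal := (ENNReal.toReal_le_toReal ht hx.ne).2 h1.le
        apply mul_nonneg <;> linarith
      · simp [h2]
      · have : (L x).toReal ≤ t.toReal := (ENNReal.toReal_le_toReal hx.ne ht).2 (not_lt.1 h1)
        apply mul_nonneg_of_nonpos_of_nonpos <;> linarith
    have hLi : Integrable (fun x => (L x).toReal) P := by
      refine integrable_toReal_of_lintegral_ne_top hL.aemeasurable ?_
      rw [← setLIntegral_univ, ← withDensity_apply _ MeasurableSet.univ]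
      exact measure_ne_top _ _
    have hmul : ∀ {θ : Ω → ℝ}, IsRejectionRule θ → Integrable (fun x => (L x).toReal * θ x) P := by
      intro θ hθ
      refine hLi.mul_bdd (c := 1) hθ.1.aestronglyMeasurable (Filter.Eventually.of_forall fun x => ?_)
      rw [Real.norm_eq_abs, abs_of_nonneg (hθ.2 x).1]; exact (hθ.2 x).2
    have e : ∀ {θ : Ω → ℝ}, ∫ x, θ x ∂(P.withDensity L) = ∫ x, (L x).toReal * θ x ∂P := by
      intro θ
      simpa using integral_withDensity_eq_integral_toReal_smul hL hfin θ
    have e2 : ∫ x, (lrt L t c x - ψ x) * ((L x).toReal - t.toReal) ∂P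
        = (∫ x, (L x).toReal * lrt L t c x ∂P - ∫ x, (L x).toReal * ψ x ∂P)
          - t.toReal * (∫ x, lrt L t c x ∂P - ∫ x, ψ x ∂P) := by
      have e3 : ∀ x, (lrt L t c x - ψ x) * ((L x).toReal - t.toReal)
          = ((L x).toReal * lrt L t c x - (L x).toReal * ψ x)
            - t.toReal * (lrt L t c x - ψ x) := fun x => by ring
      simp_rw [e3]
      rw [integral_sub ((hmul hφ).sub' (hmul hψ))
          (((hφ.integrable P).sub' (hψ.integrable P)).const_mul _),
        integral_sub (hmul hφ) (hmul hψ), integral_const_mul,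
        integral_sub (hφ.integrable P) (hψ.integrable P)]
    rw [e, e]
    have := mul_nonneg (ENNReal.toReal_nonneg (a := t)) (sub_nonneg.2 h)
    linarith

lemma bddBelow_typeII (P Q : Measure Ω) (α : ℝ) :
    BddBelow {β : ℝ | ∃ φ : Ω → ℝ, IsRejectionRule φ ∧ ∫ x, φ x ∂P ≤ α ∧
      β = ∫ x, (1 - φ x) ∂Q} := by
  refine ⟨0, ?_⟩
  rintro _ ⟨φ, hφ, -, rfl⟩
  exact integral_nonneg fun x => sub_nonneg.2 (hφ.2 x).2

lemma tradeOff_lrt {L : Ω → ℝ≥0∞} (hL : Measurable L) (P : Measure Ω) [IsProbabilityMeasure P]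
    [IsProbabilityMeasure (P.withDensity L)] (t : ℝ≥0∞) {c : ℝ} (hc : c ∈ Set.Icc (0 : ℝ) 1) :
    tradeOff P (P.withDensity L) (∫ x, lrt L t c x ∂P)
      = ∫ x, (1 - lrt L t c x) ∂(P.withDensity L) := by
  refine IsLeast.csInf_eq ⟨⟨_, isRejectionRule_lrt hL t hc, le_rfl, rfl⟩, ?_⟩
  rintro _ ⟨ψ, hψ, h, rfl⟩
  rw [(isRejectionRule_lrt hL t hc).integral_one_sub, hψ.integral_one_sub]
  have := integral_le_integral_lrt hL P t hc hψ h
  linarith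

lemma tradeOff_lrtTypeI (P Q : Measure Ω) [IsProbabilityMeasure P] [IsProbabilityMeasure Q]
    (hQ : Q ≪ P) (t : ℝ≥0∞) {c : ℝ} (hc : c ∈ Set.Icc (0 : ℝ) 1) :
    tradeOff P Q (lrtTypeI P Q t c) = ∫ x, (1 - lrt (Q.rnDeriv P) t c x) ∂Q := by
  have e := Measure.withDensity_rnDeriv_eq Q P hQ
  have : IsProbabilityMeasure (P.withDensity (Q.rnDeriv P)) := by rwa [e]
  have := tradeOff_lrt (Measure.measurable_rnDeriv Q P) P t hc
  rwa [e, integral_lrt_rnDeriv] at this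

lemma idTradeOff_lrtTypeI (P : Measure Ω) [IsProbabilityMeasure P] (t : ℝ≥0∞) {c : ℝ}
    (hc : c ∈ Set.Icc (0 : ℝ) 1) :
    idTradeOff (lrtTypeI P P t c) = ∫ x, (1 - lrt (P.rnDeriv P) t c x) ∂P := by
  rw [(isRejectionRule_lrt (Measure.measurable_rnDeriv P P) t hc).integral_one_sub,
    integral_lrt_rnDeriv, idTradeOff]

/-- Every level is the level of a likelihood-ratio test: the threshold is the upper `α`-quantile of
the likelihood ratio, and the tie probability splits the atom there. -/
lemma exists_integral_lrt_eq {L : Ω → ℝ≥0∞} (hL : Measurable L) (P : Measure Ω)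
    [IsProbabilityMeasure P] {α : ℝ} (hα : α ∈ Set.Icc (0 : ℝ) 1) :
    ∃ t : ℝ≥0∞, ∃ c ∈ Set.Icc (0 : ℝ) 1, ∫ x, lrt L t c x ∂P = α := by
  have hm : ∀ t, MeasurableSet {x | t < L x} := fun t => measurableSet_lt measurable_const hL
  set S : Set ℝ≥0∞ := {t | P {x | t < L x} ≤ ENNReal.ofReal α} with hS
  have hSne : S.Nonempty := ⟨∞, by simp [hS]⟩
  set t := sInf S with ht
  have h1 : P {x | t < L x} ≤ ENNReal.ofReal α := by
    obtain ⟨u, hu, hut, huS⟩ := exists_seq_tendsto_sInf hSne (OrderBot.bddBelow S)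
    have hU : {x | t < L x} = ⋃ k, {x | u k < L x} := by
      ext x
      simp only [Set.mem_ofPred_eq, Set.mem_iUnion]
      constructor
      · intro hx
        exact (hut.eventually (gt_mem_nhds hx)).exists
      · rintro ⟨k, hk⟩
        exact (sInf_le (huS k)).trans_lt hk
    have hmono : Monotone fun k => {x | u k < L x} := fun i j hij x hx => (hu hij).trans_lt hx
    rw [hU, hmono.measure_iUnion]
    exact iSup_le fun k => huS k
  have h2 : ENNReal.ofReal α ≤ P {x | t ≤ L x} := by
    rcases eq_or_ne t 0 with h0 | h0
    · simp only [h0, zero_le, Set.ofPred_true, measure_univ]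
      exact ENNReal.ofReal_le_one.2 hα.2
    · obtain ⟨u, hu, hut, hutt⟩ := exists_seq_strictMono_tendsto' (pos_iff_ne_zero.2 h0)
      have hI : {x | t ≤ L x} = ⋂ k, {x | u k < L x} := by
        ext x
        simp only [Set.mem_ofPred_eq, Set.mem_iInter]
        constructor
        · exact fun hx k => (hut k).2.trans_le hx
        · exact fun hx => le_of_tendsto' hutt fun k => (hx k).le
      have hanti : Antitone fun k => {x | u k < L x} :=
        fun i j hij x hx => (hu.monotone hij).trans_lt hx
      rw [hI, hanti.measure_iInter (fun k => (hm _).nullMeasurableSet) ⟨0, measure_ne_top _ _⟩]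
      refine le_iInf fun k => ?_
      by_contra hk
      exact absurd (sInf_le (show u k ∈ S from (not_le.1 hk).le)) (not_le.2 (hut k).2)
  have h1' : P.real {x | t < L x} ≤ α := ENNReal.toReal_le_of_le_ofReal hα.1 h1
  have h2' : α ≤ P.real {x | t < L x} + P.real {x | L x = t} := by
    rw [← measureReal_union _ (measurableSet_eq_fun hL measurable_const)]
    · have : {x | t < L x} ∪ {x | L x = t} = {x | t ≤ L x} := by
        ext x
        simp [le_iff_lt_or_eq, eq_comm]
      rw [this]
      exact (ENNReal.ofReal_le_iff_le_toReal (measure_ne_top _ _)).1 h2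
    · exact Set.disjoint_left.2 fun x (hx : t < L x) (hx' : L x = t) => hx.ne' hx'
  refine ⟨t, (α - P.real {x | t < L x}) / P.real {x | L x = t}, ⟨?_, ?_⟩, ?_⟩
  · exact div_nonneg (by linarith) measureReal_nonneg
  · exact div_le_one_of_le₀ (by linarith) measureReal_nonneg
  · rw [integral_lrt hL]
    rcases eq_or_ne (P.real {x | L x = t}) 0 with h0 | h0
    · rw [h0] at h2' ⊢; simp; linarith
    · rw [div_mul_cancel₀ _ h0]; ring

end NeymanPearson

/-! ### Comparison of testing problems -/

section Dominates

variable {Ω Ω' Ω'' : Type*} [MeasurableSpace Ω] [MeasurableSpace Ω'] [MeasurableSpace Ω'']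

/-- `P` against `Q` is at least as easy to test as `P'` against `Q'`: every test of `P'` against
`Q'` is matched by a test of `P` against `Q` with at most the same level and at least the same
power. -/
def TestDominates (P Q : Measure Ω) (P' Q' : Measure Ω') : Prop :=
  ∀ ψ : Ω' → ℝ, IsRejectionRule ψ → ∃ φ : Ω → ℝ, IsRejectionRule φ ∧
    ∫ x, φ x ∂P ≤ ∫ x, ψ x ∂P' ∧ ∫ x, ψ x ∂Q' ≤ ∫ x, φ x ∂Q

lemma TestDominates.trans {P Q : Measure Ω} {P' Q' : Measure Ω'} {P'' Q'' : Measure Ω''}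
    (h : TestDominates P Q P' Q') (h' : TestDominates P' Q' P'' Q'') :
    TestDominates P Q P'' Q'' := by
  intro ψ hψ
  obtain ⟨θ, hθ, h1, h2⟩ := h' ψ hψ
  obtain ⟨φ, hφ, h3, h4⟩ := h θ hθ
  exact ⟨φ, hφ, h3.trans h1, h2.trans h4⟩

/-- Post-processing cannot make testing easier. -/
lemma testDominates_map (P Q : Measure Ω) {f : Ω → Ω'} (hf : Measurable f) :
    TestDominates P Q (P.map f) (Q.map f) := by
  intro ψ hψ
  refine ⟨ψ ∘ f, hψ.comp hf, ?_, ?_⟩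
  · rw [integral_map hf.aemeasurable hψ.1.aestronglyMeasurable]; rfl
  · rw [integral_map hf.aemeasurable hψ.1.aestronglyMeasurable]; rfl

/-- Two equal distributions can only be tested by guessing. -/
lemma testDominates_self (P : Measure Ω) [IsProbabilityMeasure P] (P' : Measure Ω')
    [IsProbabilityMeasure P'] : TestDominates P P P' P' := by
  intro ψ hψ
  refine ⟨fun _ => ∫ x, ψ x ∂P', isRejectionRule_const
    ⟨hψ.integral_nonneg _, hψ.integral_le_one _⟩, ?_, ?_⟩ <;> simp

lemma TestDominates.tradeOff_le {P Q : Measure Ω} {P' Q' : Measure Ω'} [IsProbabilityMeasure Q]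
    [IsProbabilityMeasure Q'] (h : TestDominates P Q P' Q') {α : ℝ} (hα : 0 ≤ α) :
    tradeOff P Q α ≤ tradeOff P' Q' α := by
  refine le_csInf ⟨_, fun _ => 0, isRejectionRule_const (by simp), by simpa using hα, rfl⟩ ?_
  rintro _ ⟨ψ, hψ, hl, rfl⟩
  obtain ⟨φ, hφ, h1, h2⟩ := h ψ hψ
  refine (csInf_le (bddBelow_typeII P Q α) ⟨φ, hφ, h1.trans hl, rfl⟩).trans ?_
  rw [hφ.integral_one_sub, hψ.integral_one_sub]
  linarith

end Dominates

/-! ### Mixtures -/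

section Mixture

variable {ι : Type*}

variable {Ω : ι → Type*} [∀ i, MeasurableSpace (Ω i)]

lemma measurable_sigmaMk (i : ι) : Measurable (Sigma.mk i : Ω i → Σ i, Ω i) :=
  Measurable.of_le_map (iInf_le _ i)

lemma measurable_sigma_of_forall {β : Type*} [MeasurableSpace β] {f : (Σ i, Ω i) → β}
    (h : ∀ i, Measurable fun x => f ⟨i, x⟩) : Measurable f := by
  intro s hs
  rw [Sigma.instMeasurableSpace, MeasurableSpace.measurableSet_iInf]
  exact fun i => h i hs

variable [Fintype ι]

/-- The mixture of the laws `μ i` with weights `w i` in which the component is observed along with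
the sample. -/
def taggedMixture (w : ι → ℝ) (μ : ∀ i, Measure (Ω i)) : Measure (Σ i, Ω i) :=
  ∑ i, ENNReal.ofReal (w i) • (μ i).map (Sigma.mk i)

lemma integral_sum_ofReal_smul {Ω : Type*} [MeasurableSpace Ω] {w : ι → ℝ} (hw : ∀ i, 0 ≤ w i)
    (μ : ι → Measure Ω) [∀ i, IsFiniteMeasure (μ i)] {φ : Ω → ℝ} (hφ : IsRejectionRule φ) :
    ∫ x, φ x ∂(∑ i, ENNReal.ofReal (w i) • μ i) = ∑ i, w i * ∫ x, φ x ∂(μ i) := by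
  rw [integral_finsetSum_measure fun i _ =>
    (hφ.integrable (μ i)).smul_measure ENNReal.ofReal_ne_top]
  refine Finset.sum_congr rfl fun i _ => ?_
  rw [integral_smul_measure, ENNReal.toReal_ofReal (hw i), smul_eq_mul]

lemma isProbabilityMeasure_sum_ofReal_smul {Ω : Type*} [MeasurableSpace Ω] {w : ι → ℝ}
    (hw : ∀ i, 0 ≤ w i) (hw1 : ∑ i, w i = 1) (μ : ι → Measure Ω)
    [∀ i, IsProbabilityMeasure (μ i)] :
    IsProbabilityMeasure (∑ i, ENNReal.ofReal (w i) • μ i) := by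
  constructor
  simp [Measure.finsetSum_apply, ← ENNReal.ofReal_sum_of_nonneg fun i _ => hw i, hw1]

lemma isProbabilityMeasure_taggedMixture {w : ι → ℝ} (hw : ∀ i, 0 ≤ w i) (hw1 : ∑ i, w i = 1)
    (μ : ∀ i, Measure (Ω i)) [∀ i, IsProbabilityMeasure (μ i)] :
    IsProbabilityMeasure (taggedMixture w μ) := by
  have : ∀ i, IsProbabilityMeasure ((μ i).map (Sigma.mk i)) := fun i =>
    Measure.isProbabilityMeasure_map (measurable_sigmaMk i).aemeasurable
  exact isProbabilityMeasure_sum_ofReal_smul hw hw1 _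

lemma integral_taggedMixture {w : ι → ℝ} (hw : ∀ i, 0 ≤ w i) (μ : ∀ i, Measure (Ω i))
    [∀ i, IsProbabilityMeasure (μ i)] {φ : (Σ i, Ω i) → ℝ} (hφ : IsRejectionRule φ) :
    ∫ x, φ x ∂(taggedMixture w μ) = ∑ i, w i * ∫ x, φ ⟨i, x⟩ ∂(μ i) := by
  have : ∀ i, IsProbabilityMeasure ((μ i).map (Sigma.mk i)) := fun i =>
    Measure.isProbabilityMeasure_map (measurable_sigmaMk i).aemeasurable
  rw [taggedMixture, integral_sum_ofReal_smul hw _ hφ]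
  refine Finset.sum_congr rfl fun i _ => ?_
  rw [integral_map (measurable_sigmaMk i).aemeasurable hφ.1.aestronglyMeasurable]

/-- The likelihood ratio of tagged mixtures with the same weights is the likelihood ratio of the
observed component. -/
lemma taggedMixture_withDensity (w : ι → ℝ) (P Q : ∀ i, Measure (Ω i))
    [∀ i, IsProbabilityMeasure (P i)] [∀ i, IsProbabilityMeasure (Q i)] (h : ∀ i, Q i ≪ P i) :
    (taggedMixture w P).withDensity (fun x => (Q x.1).rnDeriv (P x.1) x.2) = taggedMixture w Q := by
  have hL : Measurable (fun x : Σ i, Ω i => (Q x.1).rnDeriv (P x.1) x.2) :=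
    measurable_sigma_of_forall fun i => Measure.measurable_rnDeriv (Q i) (P i)
  ext s hs
  rw [withDensity_apply _ hs, taggedMixture, taggedMixture, ← lintegral_indicator hs,
    lintegral_finsetSum_measure, Measure.finsetSum_apply]
  refine Finset.sum_congr rfl fun i _ => ?_
  rw [lintegral_smul_measure, lintegral_map (hL.indicator hs) (measurable_sigmaMk i),
    Measure.smul_apply, Measure.map_apply (measurable_sigmaMk i) hs]
  congr 1
  conv_rhs => rw [← Measure.withDensity_rnDeriv_eq (Q i) (P i) (h i),
    withDensity_apply _ (measurable_sigmaMk i hs),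
    ← lintegral_indicator (measurable_sigmaMk i hs)]
  rfl

/-- A mixture of testing problems is no easier than the tagged mixture of problems that dominate
the components. -/
lemma testDominates_taggedMixture {w : ι → ℝ} (hw : ∀ i, 0 ≤ w i) (P Q : ∀ i, Measure (Ω i))
    [∀ i, IsProbabilityMeasure (P i)] [∀ i, IsProbabilityMeasure (Q i)] {Ω' : Type*}
    [MeasurableSpace Ω'] (P' Q' : ι → Measure Ω') [∀ i, IsProbabilityMeasure (P' i)]
    [∀ i, IsProbabilityMeasure (Q' i)] (h : ∀ i, TestDominates (P i) (Q i) (P' i) (Q' i)) :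
    TestDominates (taggedMixture w P) (taggedMixture w Q)
      (∑ i, ENNReal.ofReal (w i) • P' i) (∑ i, ENNReal.ofReal (w i) • Q' i) := by
  intro ψ hψ
  choose φ hφ h1 h2 using fun i => h i ψ hψ
  have hΦ : IsRejectionRule fun x : Σ i, Ω i => φ x.1 x.2 :=
    ⟨measurable_sigma_of_forall fun i => (hφ i).1, fun x => (hφ x.1).2 x.2⟩
  refine ⟨_, hΦ, ?_, ?_⟩
  · rw [integral_taggedMixture hw P hΦ, integral_sum_ofReal_smul hw P' hψ]
    exact Finset.sum_le_sum fun i _ => mul_le_mul_of_nonneg_left (h1 i) (hw i)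
  · rw [integral_taggedMixture hw Q hΦ, integral_sum_ofReal_smul hw Q' hψ]
    exact Finset.sum_le_sum fun i _ => mul_le_mul_of_nonneg_left (h2 i) (hw i)

end Mixture

/-! ### Isotropic Gaussians -/

section Gaussian

lemma map_withDensity_comp {Ω Ω' : Type*} [MeasurableSpace Ω] [MeasurableSpace Ω']
    (μ : Measure Ω) {g : Ω → Ω'} (hg : Measurable g) {f : Ω' → ℝ≥0∞} (hf : Measurable f) :
    (μ.withDensity (f ∘ g)).map g = (μ.map g).withDensity f := by
  ext s hs
  rw [Measure.map_apply hg hs, withDensity_apply _ (hg hs), withDensity_apply _ hs,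
    setLIntegral_map hs hf hg]
  rfl

lemma pi_withDensity {ι : Type*} [Fintype ι] {Ω : ι → Type*} [∀ i, MeasurableSpace (Ω i)]
    (μ : ∀ i, Measure (Ω i)) [∀ i, IsProbabilityMeasure (μ i)] {f : ∀ i, Ω i → ℝ≥0∞}
    (hf : ∀ i, Measurable (f i)) [∀ i, SigmaFinite ((μ i).withDensity (f i))] :
    Measure.pi (fun i => (μ i).withDensity (f i))
      = (Measure.pi μ).withDensity (fun x => ∏ i, f i (x i)) := by
  refine Measure.pi_eq fun s hs => ?_
  have hX : ∀ i, Measurable ((s i).indicator (f i)) := fun i => (hf i).indicator (hs i)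
  rw [withDensity_apply _ (MeasurableSet.univ_pi hs),
    ← lintegral_indicator (MeasurableSet.univ_pi hs)]
  have e : (Set.univ.pi s).indicator (fun x => ∏ i, f i (x i))
      = fun x => ∏ i, (s i).indicator (f i) (x i) := by
    ext x
    by_cases hx : x ∈ Set.univ.pi s
    · rw [Set.indicator_of_mem hx]
      exact Finset.prod_congr rfl fun i _ => (Set.indicator_of_mem (hx i trivial) _).symm
    · rw [Set.indicator_of_notMem hx]
      simp only [Set.mem_univ_pi, not_forall] at hx
      obtain ⟨i, hi⟩ := hx
      exact (Finset.prod_eq_zero (Finset.mem_univ i) (Set.indicator_of_notMem hi _)).symm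
  have hind := lintegral_prod_eq_prod_lintegral_of_indepFun (μ := Measure.pi μ) Finset.univ
    (fun i x => (s i).indicator (f i) (x i))
    (iIndepFun_pi fun i => (hX i).aemeasurable) fun i => (hX i).comp (measurable_pi_apply i)
  rw [e, hind]
  refine Finset.prod_congr rfl fun i _ => ?_
  rw [(measurePreserving_eval μ i).lintegral_comp (hX i), lintegral_indicator (hs i),
    withDensity_apply _ (hs i)]

lemma gaussianReal_eq_withDensity_gaussianReal (m : ℝ) {v : ℝ≥0} (hv : v ≠ 0) :
    gaussianReal m v = (gaussianReal 0 1).withDensity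
      (fun x => ENNReal.ofReal ((√v)⁻¹ * Real.exp (x ^ 2 / 2 - (x - m) ^ 2 / (2 * v)))) := by
  rw [gaussianReal_of_var_ne_zero m hv, gaussianReal_of_var_ne_zero 0 one_ne_zero,
    ← withDensity_mul _ (measurable_gaussianPDF 0 1) (by fun_prop)]
  congr 1
  ext x
  rw [Pi.mul_apply, gaussianPDF, gaussianPDF, ← ENNReal.ofReal_mul (gaussianPDFReal_nonneg _ _ _),
    gaussianPDFReal, gaussianPDFReal]
  congr 1
  rw [Real.sqrt_mul (by positivity), mul_inv]
  have : Real.exp (-(x - m) ^ 2 / (2 * v))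
      = Real.exp (-(x - 0) ^ 2 / (2 * (1 : ℝ≥0)))
        * Real.exp (x ^ 2 / 2 - (x - m) ^ 2 / (2 * v)) := by
    rw [← Real.exp_add]
    congr 1
    simp
    ring
  rw [this]
  simp
  ring

variable {n : ℕ}

/-- The Gaussian law on `ℝⁿ` with mean `m` and covariance `v • I`. -/
def isoGaussian (m : EuclideanSpace ℝ (Fin n)) (v : ℝ≥0) : Measure (EuclideanSpace ℝ (Fin n)) :=
  (Measure.pi fun i => gaussianReal (m i) v).map (WithLp.toLp 2)

instance (m : EuclideanSpace ℝ (Fin n)) (v : ℝ≥0) : IsProbabilityMeasure (isoGaussian m v) :=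
  Measure.isProbabilityMeasure_map (by fun_prop)

lemma isoGaussian_zero_one :
    isoGaussian (0 : EuclideanSpace ℝ (Fin n)) 1 = stdGaussian (EuclideanSpace ℝ (Fin n)) :=
  map_pi_eq_stdGaussian

lemma map_affine_stdGaussian (m : EuclideanSpace ℝ (Fin n)) (s : ℝ≥0) :
    (stdGaussian (EuclideanSpace ℝ (Fin n))).map (fun z => m + (s : ℝ) • z)
      = isoGaussian m (s ^ 2) := by
  have h1 : ∀ i, (gaussianReal 0 1).map (fun x => m i + s * x) = gaussianReal (m i) (s ^ 2) := by
    intro i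
    rw [show (fun x => m i + s * x) = (m i + ·) ∘ ((s : ℝ) * ·) from rfl,
      ← Measure.map_map (by fun_prop) (by fun_prop), gaussianReal_map_const_mul,
      gaussianReal_map_const_add]
    congr 1
    · ring
    · rw [mul_one]; rfl
  rw [← map_pi_eq_stdGaussian, Measure.map_map (by fun_prop) (by fun_prop), isoGaussian]
  simp_rw [← h1]
  have : ∀ i, SigmaFinite ((gaussianReal 0 1).map (fun x => m i + s * x)) := by
    intro i
    rw [h1]
    infer_instance
  rw [← Measure.pi_map_pi (fun i => by fun_prop), Measure.map_map (by fun_prop) (by fun_prop)]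
  congr 1

lemma isoGaussian_eq_withDensity (m : EuclideanSpace ℝ (Fin n)) {v : ℝ≥0} (hv : v ≠ 0) :
    isoGaussian m v = (stdGaussian (EuclideanSpace ℝ (Fin n))).withDensity (fun x =>
      ENNReal.ofReal ((√v)⁻¹ ^ n * Real.exp (‖x‖ ^ 2 / 2 - ‖x - m‖ ^ 2 / (2 * v)))) := by
  have : ∀ i, SigmaFinite ((gaussianReal 0 1).withDensity (fun x =>
      ENNReal.ofReal ((√v)⁻¹ * Real.exp (x ^ 2 / 2 - (x - m i) ^ 2 / (2 * v))))) := by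
    intro i
    rw [← gaussianReal_eq_withDensity_gaussianReal (m i) hv]
    infer_instance
  rw [isoGaussian, ← map_pi_eq_stdGaussian, ← map_withDensity_comp _ (by fun_prop) (by fun_prop)]
  congr 1
  simp_rw [fun i => gaussianReal_eq_withDensity_gaussianReal (m i) hv]
  rw [pi_withDensity _ (by fun_prop)]
  congr 1
  ext x
  rw [← ENNReal.ofReal_prod_of_nonneg fun i _ => by positivity, Finset.prod_mul_distrib,
    Finset.prod_const, ← Real.exp_sum, Finset.sum_sub_distrib, ← Finset.sum_div, ← Finset.sum_div]
  simp [EuclideanSpace.real_norm_sq_eq]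

lemma integral_isoGaussian (m : EuclideanSpace ℝ (Fin n)) (s : ℝ≥0)
    {φ : EuclideanSpace ℝ (Fin n) → ℝ} (hφ : IsRejectionRule φ) :
    ∫ x, φ x ∂(isoGaussian m (s ^ 2)) = ∫ z, φ (m + (s : ℝ) • z) ∂(stdGaussian _) := by
  rw [← map_affine_stdGaussian, integral_map (by fun_prop) hφ.1.aestronglyMeasurable]

lemma isoGaussian_neg_one (m : EuclideanSpace ℝ (Fin n)) :
    isoGaussian (-m) 1 = (stdGaussian (EuclideanSpace ℝ (Fin n))).withDensity
      (fun z => ENNReal.ofReal (Real.exp (-inner ℝ z m - ‖m‖ ^ 2 / 2))) := by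
  rw [isoGaussian_eq_withDensity (-m) one_ne_zero]
  congr 1
  ext z
  rw [sub_neg_eq_add, norm_add_sq_real]
  simp
  ring_nf

lemma integrable_exp_neg_inner (m : EuclideanSpace ℝ (Fin n)) :
    Integrable (fun z => Real.exp (-inner ℝ z m - ‖m‖ ^ 2 / 2)) (stdGaussian _) := by
  have h := isoGaussian_neg_one m
  refine (lintegral_ofReal_ne_top_iff_integrable (by fun_prop)
    (Filter.Eventually.of_forall fun z => by positivity)).1 ?_
  rw [← setLIntegral_univ, ← withDensity_apply _ MeasurableSet.univ, ← h]
  exact measure_ne_top _ _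

/-- The Cameron-Martin formula. -/
lemma integral_stdGaussian_eq_shift (m : EuclideanSpace ℝ (Fin n))
    {φ : EuclideanSpace ℝ (Fin n) → ℝ} (hφ : IsRejectionRule φ) :
    ∫ x, φ x ∂(stdGaussian _)
      = ∫ z, Real.exp (-inner ℝ z m - ‖m‖ ^ 2 / 2) * φ (m + z) ∂(stdGaussian _) := by
  have h := isoGaussian_neg_one m
  have h2 := integral_isoGaussian (-m) 1 (hφ.comp (measurable_const_add m))
  rw [one_pow, h, integral_withDensity_eq_integral_toReal_smul (by fun_prop) (by simp)] at h2
  simp only [Function.comp_apply, NNReal.coe_one, one_smul, add_neg_cancel_left] at h2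
  rw [← h2]
  refine integral_congr_ae (Filter.Eventually.of_forall fun z => ?_)
  simp only [smul_eq_mul]
  rw [ENNReal.toReal_ofReal (by positivity)]

/-- The standard Gaussian mass of a ball (here, of a bounded antitone function of the distance to
the centre) decreases as the centre moves away from the origin. The reflection that exchanges the
two centres maps the points closer to the far centre to points of larger Gaussian density. -/
lemma integral_antitone_norm_sub_le {h : ℝ → ℝ} (hh : Antitone h) (h01 : ∀ r, 0 ≤ h r ∧ h r ≤ 1)
    {c c' : EuclideanSpace ℝ (Fin n)} (hc : ‖c‖ ≤ ‖c'‖) :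
    ∫ x, h ‖x - c'‖ ∂(stdGaussian _) ≤ ∫ x, h ‖x - c‖ ∂(stdGaussian _) := by
  have hrule : ∀ a : EuclideanSpace ℝ (Fin n), IsRejectionRule fun x => h ‖x - a‖ :=
    fun a => ⟨hh.measurable.comp (by fun_prop), fun x => h01 _⟩
  have hrule' : ∀ a : EuclideanSpace ℝ (Fin n), IsRejectionRule fun x => h ‖x + a‖ :=
    fun a => ⟨hh.measurable.comp (by fun_prop), fun x => h01 _⟩
  set m : EuclideanSpace ℝ (Fin n) := (1 / 2 : ℝ) • (c + c') with hm
  set d : EuclideanSpace ℝ (Fin n) := (1 / 2 : ℝ) • (c' - c) with hd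
  have hdm : 0 ≤ inner ℝ d m := by
    have : inner ℝ d m = (‖c'‖ ^ 2 - ‖c‖ ^ 2) / 4 := by
      rw [hm, hd, real_inner_smul_left, real_inner_smul_right, inner_sub_left, inner_add_right,
        inner_add_right, real_inner_self_eq_norm_sq, real_inner_self_eq_norm_sq,
        real_inner_comm c c']
      ring
    rw [this]
    have := pow_le_pow_left₀ (norm_nonneg _) hc 2
    linarith
  have hcd : ∀ z, m + z - c = z + d := fun z => by rw [hm, hd]; module
  have hcd' : ∀ z, m + z - c' = z - d := fun z => by rw [hm, hd]; module
  set ρ : EuclideanSpace ℝ (Fin n) → ℝ := fun z => Real.exp (-inner ℝ z m - ‖m‖ ^ 2 / 2) with hρ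
  have hρi : Integrable ρ (stdGaussian _) := integrable_exp_neg_inner m
  have hmul : ∀ {θ : EuclideanSpace ℝ (Fin n) → ℝ}, IsRejectionRule θ →
      Integrable (fun z => ρ z * θ z) (stdGaussian _) := by
    intro θ hθ
    refine hρi.mul_bdd (c := 1) hθ.1.aestronglyMeasurable (Filter.Eventually.of_forall fun x => ?_)
    rw [Real.norm_eq_abs, abs_of_nonneg (hθ.2 x).1]
    exact (hθ.2 x).2
  set D : EuclideanSpace ℝ (Fin n) → ℝ := fun z => h ‖z + d‖ - h ‖z - d‖ with hD
  have hI : ∫ x, h ‖x - c‖ ∂(stdGaussian _) - ∫ x, h ‖x - c'‖ ∂(stdGaussian _)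
      = ∫ z, ρ z * D z ∂(stdGaussian _) := by
    rw [integral_stdGaussian_eq_shift m (hrule c), integral_stdGaussian_eq_shift m (hrule c')]
    simp_rw [hcd, hcd']
    rw [← integral_sub (hmul (hrule' d)) (hmul (hrule d))]
    simp_rw [hD, mul_sub]
  have hDi : Integrable (fun z => ρ z * D z) (stdGaussian _) := by
    simp_rw [hD, mul_sub]
    exact (hmul (hrule' d)).sub (hmul (hrule d))
  let R : EuclideanSpace ℝ (Fin n) ≃ₗᵢ[ℝ] EuclideanSpace ℝ (Fin n) :=
    ((ℝ ∙ d)ᗮ).reflection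
  have hR : MeasurePreserving R (stdGaussian _) (stdGaussian _) :=
    ⟨R.continuous.measurable, stdGaussian_map R⟩
  have hRd : R d = -d := Submodule.reflection_orthogonalComplement_singleton_eq_neg d
  have hDR : ∀ z, D (R z) = -D z := by
    intro z
    have e1 : ‖R z + d‖ = ‖z - d‖ := by
      rw [← R.norm_map (z - d), map_sub, hRd, sub_neg_eq_add]
    have e2 : ‖R z - d‖ = ‖z + d‖ := by
      rw [← R.norm_map (z + d), map_add, hRd, sub_eq_add_neg]
    simp only [hD, e1, e2, neg_sub]
  have hRz : ∀ z, inner ℝ (R z) m = inner ℝ z m - 2 * (inner ℝ d z / ‖d‖ ^ 2) * inner ℝ d m := by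
    intro z
    have : R z = z - (2 * (inner ℝ d z / ‖d‖ ^ 2)) • d := by
      change ((ℝ ∙ d)ᗮ).reflection z = _
      rw [Submodule.reflection_orthogonal_apply, Submodule.reflection_singleton_apply]
      simp only [RCLike.ofReal_real_eq_id, id]
      module
    rw [this, inner_sub_left, real_inner_smul_left]
  have hemb : MeasurableEmbedding R := R.toHomeomorph.measurableEmbedding
  have h2 : ∫ z, ρ z * D z ∂(stdGaussian _) = -∫ z, ρ (R z) * D z ∂(stdGaussian _) := by
    rw [← hR.integral_comp hemb, ← integral_neg]
    simp_rw [hDR, mul_neg]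
  have hDi2 : Integrable (fun z => ρ (R z) * D z) (stdGaussian _) := by
    have := (hR.integrable_comp_emb hemb).2 hDi
    simpa [Function.comp_def, hDR] using this.neg
  have h3 : 0 ≤ ∫ z, (ρ z - ρ (R z)) * D z ∂(stdGaussian _) := by
    refine integral_nonneg fun z => ?_
    have hz1 : ‖z + d‖ ^ 2 = ‖z‖ ^ 2 + 2 * inner ℝ d z + ‖d‖ ^ 2 := by
      rw [norm_add_sq_real, real_inner_comm]
    have hz2 : ‖z - d‖ ^ 2 = ‖z‖ ^ 2 - 2 * inner ℝ d z + ‖d‖ ^ 2 := by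
      rw [norm_sub_sq_real, real_inner_comm]
    rcases le_total 0 (inner ℝ d z) with hs | hs
    · refine mul_nonneg_of_nonpos_of_nonpos (sub_nonpos.2 ?_) (sub_nonpos.2 (hh ?_))
      · refine Real.exp_le_exp.2 ?_
        rw [hRz]
        have : 0 ≤ 2 * (inner ℝ d z / ‖d‖ ^ 2) * inner ℝ d m := by positivity
        linarith
      · exact le_of_sq_le_sq (by linarith) (norm_nonneg _)
    · refine mul_nonneg (sub_nonneg.2 ?_) (sub_nonneg.2 (hh ?_))
      · refine Real.exp_le_exp.2 ?_
        rw [hRz]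
        have : 2 * (inner ℝ d z / ‖d‖ ^ 2) * inner ℝ d m ≤ 0 := by
          refine mul_nonpos_of_nonpos_of_nonneg ?_ hdm
          have := div_nonpos_of_nonpos_of_nonneg hs (sq_nonneg ‖d‖)
          linarith
        linarith
      · exact le_of_sq_le_sq (by linarith) (norm_nonneg _)
  have h4 : ∫ z, (ρ z - ρ (R z)) * D z ∂(stdGaussian _)
      = ∫ z, ρ z * D z ∂(stdGaussian _) - ∫ z, ρ (R z) * D z ∂(stdGaussian _) := by
    rw [← integral_sub hDi hDi2]
    simp_rw [sub_mul]
  linarith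

lemma lrt_mono {Ω : Type*} {L : Ω → ℝ≥0∞} (t : ℝ≥0∞) {c : ℝ} (hc : c ∈ Set.Icc (0 : ℝ) 1)
    {x y : Ω} (h : L x ≤ L y) : lrt L t c x ≤ lrt L t c y := by
  unfold lrt
  rcases lt_trichotomy t (L y) with hy | hy | hy
  · rw [if_pos hy]
    split_ifs <;> linarith [hc.1, hc.2]
  · rw [if_neg (not_lt.2 (h.trans hy.ge)), if_neg (not_lt.2 hy.ge), if_pos hy.symm]
    split_ifs
    exacts [le_rfl, hc.1]
  · have hx := h.trans_lt hy
    rw [if_neg hx.not_gt, if_neg hx.ne, if_neg hy.not_gt, if_neg hy.ne]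

/-- Completing the square: for variance `v < 1` the likelihood ratio of `N(m, v I)` and `N(0, I)` is
a decreasing function of the distance to `(1 - v)⁻¹ • m`. -/
lemma likelihoodRatio_eq {v : ℝ} (hv0 : v ≠ 0) (hv1 : 1 - v ≠ 0) (x m : EuclideanSpace ℝ (Fin n)) :
    ‖x‖ ^ 2 / 2 - ‖x - m‖ ^ 2 / (2 * v)
      = ‖m‖ ^ 2 / (2 * (1 - v)) - (1 - v) / (2 * v) * ‖x - (1 - v)⁻¹ • m‖ ^ 2 := by
  rw [norm_sub_sq_real, norm_sub_sq_real, real_inner_smul_right, norm_smul, mul_pow,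
    Real.norm_eq_abs, sq_abs]
  field_simp
  ring

/-- For a common variance below `1`, moving the mean of the alternative away from the origin makes
testing against `N(0, I)` easier. The most powerful tests for the smaller mean `m` reject in balls;
moving such a ball along so that it keeps its distance to the mean of the alternative keeps the
power and lowers the level. -/
lemma testDominates_isoGaussian {s : ℝ≥0} (hs0 : s ≠ 0) (hs1 : s < 1)
    {m m' : EuclideanSpace ℝ (Fin n)} (hm : ‖m‖ ≤ ‖m'‖) :
    TestDominates (stdGaussian _) (isoGaussian m' (s ^ 2))
      (stdGaussian _) (isoGaussian m (s ^ 2)) := by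
  intro ψ hψ
  have hv0 : (0 : ℝ) < s := NNReal.coe_pos.2 (pos_iff_ne_zero.2 hs0)
  have hs1' : (s : ℝ) < 1 := by exact_mod_cast hs1
  have hv1 : 0 < 1 - (s : ℝ) ^ 2 := by nlinarith
  set k : ℝ := (1 - (s : ℝ) ^ 2)⁻¹ with hk
  have hk0 : 0 < k := inv_pos.2 hv1
  -- the likelihood ratio as a function of the distance `r` to `k • m`; truncating `r` at `0` makes it
  -- antitone on the whole line
  set Lf : ℝ → ℝ≥0∞ := fun r => ENNReal.ofReal ((√((s ^ 2 : ℝ≥0) : ℝ))⁻¹ ^ n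
    * Real.exp (‖m‖ ^ 2 / (2 * (1 - (s : ℝ) ^ 2))
      - (1 - (s : ℝ) ^ 2) / (2 * (s : ℝ) ^ 2) * (max r 0) ^ 2)) with hLf
  have hLfa : Antitone Lf := by
    intro a b hab
    refine ENNReal.ofReal_le_ofReal (mul_le_mul_of_nonneg_left (Real.exp_le_exp.2 ?_)
      (by positivity))
    have : max a 0 ≤ max b 0 := max_le_max_right 0 hab
    gcongr
  set L : EuclideanSpace ℝ (Fin n) → ℝ≥0∞ := fun x => Lf ‖x - k • m‖ with hL
  have hLm : Measurable L := hLfa.measurable.comp (by fun_prop)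
  have hLd : isoGaussian m (s ^ 2) = (stdGaussian _).withDensity L := by
    rw [isoGaussian_eq_withDensity m (pow_ne_zero 2 hs0)]
    congr 1
    ext x
    simp only [hL, hLf, max_eq_left (norm_nonneg _)]
    rw [NNReal.coe_pow, likelihoodRatio_eq (pow_ne_zero 2 hv0.ne') hv1.ne']
  have : IsProbabilityMeasure ((stdGaussian (EuclideanSpace ℝ (Fin n))).withDensity L) := by
    rw [← hLd]; infer_instance
  obtain ⟨t, c, hc, hα⟩ := exists_integral_lrt_eq hLm (stdGaussian _)
    ⟨hψ.integral_nonneg (stdGaussian _), hψ.integral_le_one (stdGaussian _)⟩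
  have hpow := integral_le_integral_lrt hLm (stdGaussian _) t hc hψ hα.ge
  rw [← hLd] at hpow
  set h : ℝ → ℝ := lrt Lf t c with hh
  have hha : Antitone h := fun a b hab => lrt_mono t hc (hLfa hab)
  have h01 : ∀ r, 0 ≤ h r ∧ h r ≤ 1 := (isRejectionRule_lrt hLfa.measurable t hc).2
  have hrule : ∀ a : EuclideanSpace ℝ (Fin n), IsRejectionRule fun x => h ‖x - a‖ :=
    fun a => ⟨hha.measurable.comp (by fun_prop), fun x => h01 _⟩
  have hLh : lrt L t c = fun x => h ‖x - k • m‖ := rfl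
  rw [hLh] at hα hpow
  -- the new centre lies beyond `m'`, at the distance from `m'` that `k • m` has from `m`
  set b : ℝ := (k - 1) * (‖m‖ / ‖m'‖) with hb
  have hk1 : 0 ≤ k - 1 := sub_nonneg.2 (by
    rw [hk]; exact (one_le_inv₀ hv1).2 (by nlinarith))
  have hb0 : 0 ≤ b := by positivity
  have hbm : b * ‖m'‖ = (k - 1) * ‖m‖ := by
    rw [hb, mul_assoc, div_mul_cancel_of_imp]
    intro h0
    exact le_antisymm (hm.trans h0.le) (norm_nonneg _)
  refine ⟨fun x => h ‖x - (1 + b) • m'‖, hrule _, ?_, ?_⟩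
  · rw [← hα]
    refine integral_antitone_norm_sub_le hha h01 ?_
    rw [norm_smul, norm_smul, Real.norm_of_nonneg hk0.le, Real.norm_of_nonneg (by linarith)]
    linarith
  · refine hpow.trans ?_
    rw [integral_isoGaussian m s (hrule _), integral_isoGaussian m' s (hrule _)]
    have e : ∀ (a w : EuclideanSpace ℝ (Fin n)) (z : EuclideanSpace ℝ (Fin n)),
        ‖a + (s : ℝ) • z - w‖ = s * ‖z - (s : ℝ)⁻¹ • (w - a)‖ := by
      intro a w z
      rw [← Real.norm_of_nonneg hv0.le, ← norm_smul, Real.norm_of_nonneg hv0.le, smul_sub,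
        smul_inv_smul₀ hv0.ne']
      congr 1
      abel
    simp_rw [e]
    refine integral_antitone_norm_sub_le (h := fun r => h (s * r))
      (fun a b hab => hha (mul_le_mul_of_nonneg_left hab hv0.le)) (fun r => h01 _) ?_
    rw [norm_smul, norm_smul]
    refine mul_le_mul_of_nonneg_left (le_of_eq ?_) (norm_nonneg _)
    rw [show k • m - m = (k - 1) • m by module, show (1 + b) • m' - m' = b • m' by module,
      norm_smul, norm_smul, Real.norm_of_nonneg hk1, Real.norm_of_nonneg hb0, hbm]

lemma map_inner_stdGaussian {u : EuclideanSpace ℝ (Fin n)} (hu : ‖u‖ = 1) :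
    (stdGaussian (EuclideanSpace ℝ (Fin n))).map (fun x => inner ℝ u x) = gaussianReal 0 1 := by
  have h := IsGaussian.map_eq_gaussianReal (μ := stdGaussian (EuclideanSpace ℝ (Fin n)))
    (innerSL ℝ u)
  rw [integral_strongDual_stdGaussian, variance_dual_stdGaussian, innerSL_apply_norm, hu] at h
  simpa using h

/-- Shifts of the standard Gaussian on `ℝⁿ` by at most `μ` are no easier to detect than the shift by
`μ` on the line: the most powerful tests reject in half-spaces orthogonal to the shift. -/
lemma testDominates_gaussianReal {μ : ℝ} {m : EuclideanSpace ℝ (Fin n)} (hm : ‖m‖ ≤ μ) :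
    TestDominates (gaussianReal 0 1) (gaussianReal μ 1) (stdGaussian _) (isoGaussian m 1) := by
  intro ψ hψ
  have hα01 : ∫ x, ψ x ∂(stdGaussian _) ∈ Set.Icc (0 : ℝ) 1 :=
    ⟨hψ.integral_nonneg _, hψ.integral_le_one _⟩
  rcases eq_or_ne m 0 with rfl | h0
  · rw [isoGaussian_zero_one]
    exact ⟨_, isRejectionRule_const hα01, by simp, by simp⟩
  have hm0 : 0 < ‖m‖ := norm_pos_iff.2 h0
  set u : EuclideanSpace ℝ (Fin n) := ‖m‖⁻¹ • m with hu
  have hu1 : ‖u‖ = 1 := by rw [hu, norm_smul, norm_inv, norm_norm, inv_mul_cancel₀ hm0.ne']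
  have hum : inner ℝ u m = ‖m‖ := by
    rw [hu, real_inner_smul_left, real_inner_self_eq_norm_sq]
    field_simp
  set Lf : ℝ → ℝ≥0∞ := fun y => ENNReal.ofReal (Real.exp (‖m‖ * y - ‖m‖ ^ 2 / 2)) with hLf
  have hLfa : Monotone Lf := by
    intro a b hab
    refine ENNReal.ofReal_le_ofReal (Real.exp_le_exp.2 ?_)
    gcongr
  set L : EuclideanSpace ℝ (Fin n) → ℝ≥0∞ := fun x => Lf (inner ℝ u x) with hL
  have hLm : Measurable L := hLfa.measurable.comp (by fun_prop)
  have hLd : isoGaussian m 1 = (stdGaussian _).withDensity L := by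
    rw [isoGaussian_eq_withDensity m one_ne_zero]
    congr 1
    ext x
    simp only [hL, hLf]
    rw [norm_sub_sq_real, hu, real_inner_smul_left, real_inner_comm, mul_inv_cancel_left₀ hm0.ne']
    simp
    ring_nf
  have : IsProbabilityMeasure ((stdGaussian (EuclideanSpace ℝ (Fin n))).withDensity L) := by
    rw [← hLd]; infer_instance
  obtain ⟨t, c, hc, hα⟩ := exists_integral_lrt_eq hLm (stdGaussian _) hα01
  have hpow := integral_le_integral_lrt hLm (stdGaussian _) t hc hψ hα.ge
  rw [← hLd] at hpow
  set h : ℝ → ℝ := lrt Lf t c with hh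
  have hr : IsRejectionRule h := isRejectionRule_lrt hLfa.measurable t hc
  have hrule : ∀ a : ℝ, IsRejectionRule fun y => h (a + y) :=
    fun a => hr.comp (measurable_const_add a)
  have hmi : Measurable fun x : EuclideanSpace ℝ (Fin n) => inner ℝ u x := by fun_prop
  have hLh : lrt L t c = fun x => h (inner ℝ u x) := rfl
  rw [hLh] at hα hpow
  have hline : ∀ a, ∫ x, h (a + inner ℝ u x) ∂(stdGaussian _)
      = ∫ y, h (a + y) ∂(gaussianReal 0 1) := by
    intro a
    rw [← map_inner_stdGaussian hu1, integral_map hmi.aemeasurable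
      (hrule a).1.aestronglyMeasurable]
  refine ⟨h, hr, ?_, ?_⟩
  · rw [← hα]
    simpa using (hline 0).ge
  · refine hpow.trans ?_
    have e1 := integral_isoGaussian m 1 (hr.comp hmi)
    simp only [one_pow, Function.comp_apply, inner_add_right, hum, NNReal.coe_one, one_smul,
      hline] at e1
    have e2 : gaussianReal μ 1 = (gaussianReal 0 1).map (μ + ·) := by
      rw [gaussianReal_map_const_add, zero_add]
    rw [e1, e2, integral_map (by fun_prop) hr.1.aestronglyMeasurable]
    exact integral_mono ((hrule _).integrable _) ((hrule _).integrable _) fun y =>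
      lrt_mono t hc (hLfa (by linarith))

end Gaussian

/-! ### One batch of the mechanism -/

section Batch

variable {n : ℕ}

/-- The output law of the mechanism on a fixed batch: the clipped vectors of the batch sum to `S`,
and the normalization factor is `k`. -/
def batchLaw (σ C k : ℝ) (S : EuclideanSpace ℝ (Fin n)) : Measure (EuclideanSpace ℝ (Fin n)) :=
  (noise n σ C).map fun z => k⁻¹ • (S + z)

lemma batchLaw_eq_map_stdGaussian (σ C k : ℝ) (S : EuclideanSpace ℝ (Fin n)) :
    batchLaw σ C k S = (stdGaussian _).map fun z => k⁻¹ • (S + (σ * C) • z) := by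
  rw [batchLaw, noise, Measure.map_map (by fun_prop) (by fun_prop)]
  rfl

instance (σ C k : ℝ) (S : EuclideanSpace ℝ (Fin n)) : IsProbabilityMeasure (batchLaw σ C k S) := by
  rw [batchLaw_eq_map_stdGaussian]
  exact Measure.isProbabilityMeasure_map (by fun_prop)

/-- The affine map that turns the standard Gaussian into the output law for one batch turns a
suitable isotropic Gaussian into the output law for another batch. -/
lemma map_isoGaussian_eq_batchLaw {σ C k k' : ℝ} {s : ℝ≥0} {m S S' : EuclideanSpace ℝ (Fin n)}
    (hs : k⁻¹ * s = k'⁻¹) (hS : k⁻¹ • (S + (σ * C) • m) = k'⁻¹ • S') :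
    (isoGaussian m (s ^ 2)).map (fun z => k⁻¹ • (S + (σ * C) • z)) = batchLaw σ C k' S' := by
  rw [batchLaw_eq_map_stdGaussian, ← map_affine_stdGaussian,
    Measure.map_map (by fun_prop) (by fun_prop)]
  congr 1
  ext1 z
  have h : k'⁻¹ • (S' + (σ * C) • z) = k⁻¹ • (S + (σ * C) • m) + (k⁻¹ * s) • ((σ * C) • z) := by
    rw [hS, hs, smul_add]
  rw [h, Function.comp_apply]
  module

lemma norm_clip_le {C : ℝ} (hC : 0 < C) (v : EuclideanSpace ℝ (Fin n)) : ‖clip C v‖ ≤ C := by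
  have h1 : 0 < max 1 (‖v‖ / C) := lt_max_of_lt_left one_pos
  rw [clip, norm_smul, norm_inv, Real.norm_of_nonneg h1.le, inv_mul_le_iff₀ h1, ← div_le_iff₀ hC]
  exact le_max_right _ _

/-- Adding one point to the empty batch. -/
lemma testDominates_batchLaw_empty {σ C : ℝ} (hσ : 0 < σ) (hC : 0 < C)
    {v : EuclideanSpace ℝ (Fin n)} (hv : ‖v‖ ≤ C) :
    TestDominates (gaussianReal 0 1) (gaussianReal (1 / σ) 1)
      (batchLaw (n := n) σ C 1 0) (batchLaw σ C 1 v) := by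
  have hm : ‖(σ * C)⁻¹ • v‖ ≤ 1 / σ := by
    rw [norm_smul, norm_inv, Real.norm_of_nonneg (by positivity), inv_mul_le_iff₀ (by positivity)]
    calc ‖v‖ ≤ C := hv
      _ = σ * C * (1 / σ) := by field_simp
  have h := (testDominates_gaussianReal hm).trans (testDominates_map _ _
    (f := fun z => (1 : ℝ)⁻¹ • ((0 : EuclideanSpace ℝ (Fin n)) + (σ * C) • z)) (by fun_prop))
  have e := map_isoGaussian_eq_batchLaw (σ := σ) (C := C) (k := 1) (k' := 1) (s := 1)
    (m := (σ * C)⁻¹ • v) (S := 0) (S' := v) (by simp)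
    (by rw [smul_inv_smul₀ (by positivity), zero_add])
  rw [one_pow] at e
  rwa [← batchLaw_eq_map_stdGaussian, e] at h

lemma map_altLaw (hn : 1 ≤ n) (b : ℕ) (μ : ℝ) :
    (altLaw n b μ).map (WithLp.toLp 2)
      = isoGaussian (EuclideanSpace.single (⟨n - 1, by omega⟩ : Fin n) μ)
        (((b : ℝ≥0) / (b + 1)) ^ 2) := by
  rw [altLaw, isoGaussian]
  congr 2
  ext1 i
  congr 1
  rw [PiLp.single_apply]
  refine if_congr ?_ rfl rfl
  rw [Fin.ext_iff]
  change (i : ℕ) + 1 = n ↔ (i : ℕ) = n - 1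
  omega

/-- Adding one point to a nonempty batch of size `b`. The worst case is that all clipped vectors
have the maximal norm, the old ones point in one direction and the new one in the opposite one. -/
lemma testDominates_batchLaw (hn : 1 ≤ n) {σ C : ℝ} (hσ : 0 < σ) (hC : 0 < C) {b : ℕ} (hb : b ≠ 0)
    {S v : EuclideanSpace ℝ (Fin n)} (hS : ‖S‖ ≤ b * C) (hv : ‖v‖ ≤ C) :
    TestDominates (nullLaw n) (altLaw n b (muBar σ b))
      (batchLaw σ C b S) (batchLaw σ C (b + 1) (S + v)) := by
  have hb0 : (0 : ℝ) < b := Nat.cast_pos.2 (Nat.pos_of_ne_zero hb)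
  have hσC : 0 < σ * C := mul_pos hσ hC
  set s : ℝ≥0 := (b : ℝ≥0) / (b + 1) with hs
  have hs' : (s : ℝ) = b / (b + 1) := by rw [hs]; push_cast; rfl
  have hs0 : s ≠ 0 := by positivity
  have hs1 : s < 1 := by
    rw [← NNReal.coe_lt_coe, hs', NNReal.coe_one, div_lt_one (by positivity)]
    linarith
  set m : EuclideanSpace ℝ (Fin n) := ((σ * C) * (b + 1))⁻¹ • ((b : ℝ) • v - S) with hm
  have hmn : ‖m‖ ≤ ‖(EuclideanSpace.single (⟨n - 1, by omega⟩ : Fin n) (muBar σ b))‖ := by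
    have h0 : 0 ≤ muBar σ b := by unfold muBar; positivity
    rw [PiLp.norm_single, Real.norm_of_nonneg h0, hm, norm_smul, norm_inv,
      Real.norm_of_nonneg (by positivity), inv_mul_le_iff₀ (by positivity)]
    calc ‖(b : ℝ) • v - S‖ ≤ ‖(b : ℝ) • v‖ + ‖S‖ := norm_sub_le _ _
      _ ≤ b * C + b * C := by
        refine add_le_add ?_ hS
        rw [norm_smul, Real.norm_of_nonneg hb0.le]
        exact mul_le_mul_of_nonneg_left hv hb0.le
      _ = σ * C * (b + 1) * muBar σ b := by
        unfold muBar
        field_simp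
        ring
  have h1 := testDominates_map (nullLaw n) (altLaw n b (muBar σ b)) (f := WithLp.toLp 2)
    (Ω' := EuclideanSpace ℝ (Fin n)) (by fun_prop)
  rw [map_altLaw hn, ← hs] at h1
  rw [nullLaw, map_pi_eq_stdGaussian] at h1
  have h2 := (h1.trans (testDominates_isoGaussian hs0 hs1 hmn)).trans (testDominates_map _ _
    (f := fun z => (b : ℝ)⁻¹ • (S + (σ * C) • z)) (by fun_prop))
  have e := map_isoGaussian_eq_batchLaw (σ := σ) (C := C) (k := b) (k' := b + 1) (s := s)
    (m := m) (S := S) (S' := S + v) (by rw [hs']; field_simp) (by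
      rw [hm, smul_smul, mul_inv, mul_inv_cancel_left₀ hσC.ne']
      match_scalars <;> field_simp
      ring)
  rwa [← batchLaw_eq_map_stdGaussian, e] at h2

end Batch

/-! ### The mechanism as a mixture -/

section Mechanism

lemma batchProb_nonneg {N : ℕ} {q : ℝ} (hq0 : 0 ≤ q) (hq1 : q ≤ 1) (B : Finset (Fin N)) :
    0 ≤ batchProb q B := by
  have := sub_nonneg.2 hq1
  unfold batchProb
  positivity

lemma sum_batchProb (N : ℕ) (q : ℝ) : ∑ B : Finset (Fin N), batchProb q B = 1 := by
  simp only [batchProb]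
  rw [Fin.sum_pow_mul_eq_add_pow, add_sub_cancel, one_pow]

lemma sum_finset_fin_succ {N : ℕ} {M : Type*} [AddCommMonoid M] (F : Finset (Fin (N + 1)) → M) :
    ∑ B, F B = ∑ B : Finset (Fin N), (F (B.map Fin.castSuccEmb)
      + F (insert (Fin.last N) (B.map Fin.castSuccEmb))) := by
  have hu : (Finset.univ : Finset (Fin (N + 1)))
      = insert (Fin.last N) (Finset.univ.map Fin.castSuccEmb) := by
    rw [Fin.univ_castSuccEmb, Finset.cons_eq_insert]
  have hp : (Finset.univ.map Fin.castSuccEmb : Finset (Fin (N + 1))).powerset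
      = Finset.univ.map (Finset.mapEmbedding (Fin.castSuccEmb (n := N))).toEmbedding := by
    ext B
    simp only [Finset.mem_powerset, Finset.mem_map, Finset.mem_univ, true_and]
    rw [Finset.subset_map_iff]
    simp [eq_comm]
  rw [← Finset.powerset_univ, hu, Finset.sum_powerset_insert (by simp), hp, Finset.sum_map,
    Finset.sum_map, ← Finset.sum_add_distrib]
  rfl

/-- The probability of the batch `B` together with the decision whether the point by which the
larger dataset exceeds the smaller one is sampled. -/
def tagWeight {N : ℕ} (q : ℝ) (i : Finset (Fin N) × Bool) : ℝ :=
  batchProb q i.1 * if i.2 then q else 1 - q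

lemma tagWeight_nonneg {N : ℕ} {q : ℝ} (hq0 : 0 ≤ q) (hq1 : q ≤ 1) (i : Finset (Fin N) × Bool) :
    0 ≤ tagWeight q i := by
  refine mul_nonneg (batchProb_nonneg hq0 hq1 _) ?_
  split_ifs
  exacts [hq0, sub_nonneg.2 hq1]

lemma sum_tagWeight_mul {N : ℕ} (q : ℝ) (F : Finset (Fin N) × Bool → ℝ) :
    ∑ i, tagWeight q i * F i
      = ∑ B, batchProb q B * ((1 - q) * F (B, false) + q * F (B, true)) := by
  rw [Fintype.sum_prod_type]
  refine Finset.sum_congr rfl fun B _ => ?_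
  rw [Fintype.sum_bool]
  simp only [tagWeight, if_true, Bool.false_eq_true, if_false]
  ring

lemma sum_tagWeight (N : ℕ) (q : ℝ) : ∑ i : Finset (Fin N) × Bool, tagWeight q i = 1 := by
  have h := sum_tagWeight_mul (N := N) q fun _ => 1
  simpa [sum_batchProb] using h

variable {X : Type*} {n N : ℕ}

lemma asgm_eq_sum (g : X → EuclideanSpace ℝ (Fin n)) {q : ℝ} (hq0 : 0 ≤ q) (hq1 : q ≤ 1) (σ C : ℝ)
    (D : Fin N → X) :
    asgm g q σ C D = ∑ i : Finset (Fin N) × Bool, ENNReal.ofReal (tagWeight q i) •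
      batchLaw σ C (normFactor i.1) (∑ j ∈ i.1, clip C (g (D j))) := by
  rw [asgm, Fintype.sum_prod_type]
  refine Finset.sum_congr rfl fun B _ => ?_
  rw [Fintype.sum_bool, ← add_smul, ← ENNReal.ofReal_add (tagWeight_nonneg hq0 hq1 _)
    (tagWeight_nonneg hq0 hq1 _)]
  simp only [tagWeight, if_true, Bool.false_eq_true, if_false]
  rw [← mul_add, add_sub_cancel, mul_one]
  rfl

lemma asgm_snoc_eq_sum (g : X → EuclideanSpace ℝ (Fin n)) (q σ C : ℝ) (D : Fin N → X) (d : X) :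
    asgm g q σ C (Fin.snoc D d : Fin (N + 1) → X)
      = ∑ i : Finset (Fin N) × Bool, ENNReal.ofReal (tagWeight q i) •
        if i.2 then batchLaw σ C (i.1.card + 1) ((∑ j ∈ i.1, clip C (g (D j))) + clip C (g d))
        else batchLaw σ C (normFactor i.1) (∑ j ∈ i.1, clip C (g (D j))) := by
  rw [asgm, sum_finset_fin_succ, Fintype.sum_prod_type]
  refine Finset.sum_congr rfl fun B _ => ?_
  have hlast : Fin.last N ∉ B.map Fin.castSuccEmb := by simp
  have hcard : B.card ≤ N := by simpa using Finset.card_le_univ B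
  have e1 : batchProb q (B.map Fin.castSuccEmb) = tagWeight q (B, false) := by
    simp only [batchProb, tagWeight, Finset.card_map, Bool.false_eq_true, if_false]
    rw [Nat.sub_add_comm hcard, pow_succ, mul_assoc]
  have e2 : batchProb q (insert (Fin.last N) (B.map Fin.castSuccEmb)) = tagWeight q (B, true) := by
    simp only [batchProb, tagWeight, Finset.card_insert_of_notMem hlast, Finset.card_map, if_true]
    rw [Nat.add_sub_add_right, pow_succ]
    ring
  have e3 : normFactor (B.map Fin.castSuccEmb) = normFactor B := by
    simp [normFactor]
  have e4 : normFactor (insert (Fin.last N) (B.map Fin.castSuccEmb)) = B.card + 1 := by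
    rw [normFactor, if_neg (Finset.insert_ne_empty _ _), Finset.card_insert_of_notMem hlast,
      Finset.card_map, Nat.cast_add_one]
  have e5 : ∑ i ∈ B.map Fin.castSuccEmb, clip C (g ((Fin.snoc D d : Fin (N + 1) → X) i))
      = ∑ j ∈ B, clip C (g (D j)) := by
    simp [Finset.sum_map]
  rw [Fintype.sum_bool, add_comm, e1, e2, e3, e4, Finset.sum_insert hlast, e5]
  simp [batchLaw, add_comm]

end Mechanism

/-! ### The lower bound as a tagged mixture -/

section LowerBound

/-- The sample space of a component of the lower bound: the line for the empty batch (`true`), `ℝⁿ`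
for the other batches. -/
def CompSpace (n : ℕ) : Bool → Type
  | true => ℝ
  | false => Fin n → ℝ

instance (n : ℕ) : ∀ e, MeasurableSpace (CompSpace n e)
  | true => inferInstanceAs (MeasurableSpace ℝ)
  | false => inferInstanceAs (MeasurableSpace (Fin n → ℝ))

/-- The null hypothesis of a component. -/
def nullComp (n : ℕ) : ∀ e, Measure (CompSpace n e)
  | true => gaussianReal 0 1
  | false => nullLaw n

/-- The alternative of a component that belongs to a batch of size `b` to which a point is added. -/
def altComp (n : ℕ) (σ : ℝ) (b : ℕ) : ∀ e, Measure (CompSpace n e)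
  | true => gaussianReal (1 / σ) 1
  | false => altLaw n b (muBar σ b)

instance (n : ℕ) : ∀ e, IsProbabilityMeasure (nullComp n e)
  | true => inferInstanceAs (IsProbabilityMeasure (gaussianReal 0 1))
  | false => inferInstanceAs (IsProbabilityMeasure (Measure.pi fun _ => gaussianReal 0 1))

instance (n : ℕ) (σ : ℝ) (b : ℕ) : ∀ e, IsProbabilityMeasure (altComp n σ b e)
  | true => inferInstanceAs (IsProbabilityMeasure (gaussianReal (1 / σ) 1))
  | false => inferInstanceAs (IsProbabilityMeasure (Measure.pi fun _ => gaussianReal _ _))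

lemma altLaw_absolutelyContinuous (n : ℕ) {b : ℕ} (hb : b ≠ 0) (μ : ℝ) :
    altLaw n b μ ≪ nullLaw n := by
  have hv : ((b : ℝ≥0) / (b + 1)) ^ 2 ≠ 0 := by positivity
  have h := fun i : Fin n =>
    gaussianReal_eq_withDensity_gaussianReal (if (i : ℕ) + 1 = n then μ else 0) hv
  rw [altLaw, nullLaw]
  have : ∀ i : Fin n, SigmaFinite ((gaussianReal 0 1).withDensity (fun x =>
      ENNReal.ofReal ((√(((b : ℝ≥0) / (b + 1)) ^ 2 : ℝ≥0))⁻¹ * Real.exp (x ^ 2 / 2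
        - (x - if (i : ℕ) + 1 = n then μ else 0) ^ 2
          / (2 * (((b : ℝ≥0) / (b + 1)) ^ 2 : ℝ≥0)))))) := by
    intro i
    rw [← h]
    infer_instance
  simp_rw [h]
  rw [pi_withDensity _ (by fun_prop)]
  exact withDensity_absolutelyContinuous _ _

lemma altComp_absolutelyContinuous (n : ℕ) (σ : ℝ) {b : ℕ} :
    ∀ {e : Bool}, (e = false → b ≠ 0) → altComp n σ b e ≪ nullComp n e
  | true, _ => (gaussianReal_absolutelyContinuous _ one_ne_zero).trans
      (gaussianReal_absolutelyContinuous' _ one_ne_zero)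
  | false, h => altLaw_absolutelyContinuous n (h rfl) _

variable {n N : ℕ}

/-- The null hypotheses of the components, indexed by the batch and the decision whether the
additional point is sampled. -/
def compNull (n : ℕ) (i : Finset (Fin N) × Bool) : Measure (CompSpace n (decide (i.1 = ∅))) :=
  nullComp n _

/-- The alternatives of the components, which differ from the null hypotheses only if the additional
point is sampled. -/
def compAlt (n : ℕ) (σ : ℝ) (i : Finset (Fin N) × Bool) :
    Measure (CompSpace n (decide (i.1 = ∅))) :=
  if i.2 then altComp n σ i.1.card _ else nullComp n _

instance (i : Finset (Fin N) × Bool) : IsProbabilityMeasure (compNull n i) := by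
  unfold compNull
  infer_instance

instance (σ : ℝ) (i : Finset (Fin N) × Bool) : IsProbabilityMeasure (compAlt n σ i) := by
  unfold compAlt
  split_ifs <;> infer_instance

lemma compAlt_absolutelyContinuous (σ : ℝ) (i : Finset (Fin N) × Bool) :
    compAlt n σ i ≪ compNull n i := by
  unfold compAlt compNull
  split_ifs
  · refine altComp_absolutelyContinuous n σ fun h => ?_
    simpa using h
  · exact Measure.AbsolutelyContinuous.rfl

lemma sum_batchProb_mul (q : ℝ) (F : Bool → ℕ → ℝ) :
    ∑ B : Finset (Fin N), batchProb q B * F (decide (B = ∅)) B.card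
      = (∑ B : Finset (Fin N) with B ≠ ∅, batchProb q B * F false B.card)
        + (1 - q) ^ N * F true 0 := by
  rw [← Finset.sum_filter_add_sum_filter_not Finset.univ (fun B : Finset (Fin N) => B ≠ ∅)]
  congr 1
  · refine Finset.sum_congr rfl fun B hB => ?_
    rw [decide_eq_false (Finset.mem_filter.1 hB).2]
  · have : (Finset.univ.filter fun B : Finset (Fin N) => ¬B ≠ ∅) = {∅} := by
      ext B
      simp
    rw [this, Finset.sum_singleton]
    simp [batchProb]

lemma lowerAlpha_eq (q σ : ℝ) (t : ℝ≥0∞) (c : ℝ) :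
    lowerAlpha n N q σ t c = ∑ i : Finset (Fin N) × Bool,
      tagWeight q i * lrtTypeI (compNull n i) (compAlt n σ i) t c := by
  rw [sum_tagWeight_mul]
  exact (sum_batchProb_mul q fun e b => (1 - q) * lrtTypeI (nullComp n e) (nullComp n e) t c
    + q * lrtTypeI (nullComp n e) (altComp n σ b e) t c).symm

lemma lowerValue_eq (q σ : ℝ) (t : ℝ≥0∞) {c : ℝ} (hc : c ∈ Set.Icc (0 : ℝ) 1) :
    lowerValue n N q σ t c = ∑ i : Finset (Fin N) × Bool, tagWeight q i *
      ∫ x, (1 - lrt ((compAlt n σ i).rnDeriv (compNull n i)) t c x) ∂(compAlt n σ i) := by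
  rw [sum_tagWeight_mul]
  have h := sum_batchProb_mul (N := N) q fun e b =>
    (1 - q) * idTradeOff (lrtTypeI (nullComp n e) (nullComp n e) t c)
      + q * tradeOff (nullComp n e) (altComp n σ b e)
        (lrtTypeI (nullComp n e) (altComp n σ b e) t c)
  refine Eq.trans h.symm (Finset.sum_congr rfl fun B _ => ?_)
  have h1 := fun i : Finset (Fin N) × Bool => idTradeOff_lrtTypeI (compNull n i) t hc
  have h2 := fun i : Finset (Fin N) × Bool => tradeOff_lrtTypeI (compNull n i) (compAlt n σ i)
    (compAlt_absolutelyContinuous σ i) t hc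
  exact congrArg₂ (fun x y => batchProb q B * ((1 - q) * x + q * y)) (h1 (B, false)) (h2 (B, true))

lemma testDominates_comp (hn : 1 ≤ n) {σ C : ℝ} (hσ : 0 < σ) (hC : 0 < C) {X : Type*}
    (g : X → EuclideanSpace ℝ (Fin n)) (D : Fin N → X) (d : X) (i : Finset (Fin N) × Bool) :
    TestDominates (compNull n i) (compAlt n σ i)
      (batchLaw σ C (normFactor i.1) (∑ j ∈ i.1, clip C (g (D j))))
      (if i.2 then batchLaw σ C (i.1.card + 1) ((∑ j ∈ i.1, clip C (g (D j))) + clip C (g d))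
        else batchLaw σ C (normFactor i.1) (∑ j ∈ i.1, clip C (g (D j)))) := by
  obtain ⟨B, j⟩ := i
  cases j
  · have h := fun (i : Finset (Fin N) × Bool) (S : EuclideanSpace ℝ (Fin n)) =>
      testDominates_self (compNull n i) (batchLaw σ C (normFactor i.1) S)
    exact h (B, false) _
  · rcases eq_or_ne B ∅ with rfl | hB
    · have h := testDominates_batchLaw_empty hσ hC (norm_clip_le hC (g d))
      have key : ∀ e, e = true → TestDominates (nullComp n e) (altComp n σ 0 e)
          (batchLaw σ C (normFactor (∅ : Finset (Fin N)))
            (∑ j ∈ (∅ : Finset (Fin N)), clip C (g (D j))))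
          (batchLaw σ C (((∅ : Finset (Fin N)).card : ℝ) + 1)
            ((∑ j ∈ (∅ : Finset (Fin N)), clip C (g (D j))) + clip C (g d))) := by
        rintro _ rfl
        rw [normFactor, if_pos rfl, Finset.sum_empty, Finset.card_empty, Nat.cast_zero, zero_add,
          zero_add]
        exact h
      exact key _ (decide_eq_true rfl)
    · have hS : ‖∑ j ∈ B, clip C (g (D j))‖ ≤ B.card * C := by
        refine (norm_sum_le _ _).trans ?_
        rw [← nsmul_eq_mul]
        exact Finset.sum_le_card_nsmul _ _ _ fun j _ => norm_clip_le hC _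
      have h := testDominates_batchLaw hn hσ hC (Finset.card_ne_zero.2
        (Finset.nonempty_iff_ne_empty.2 hB)) hS (norm_clip_le hC (g d))
      have key : ∀ e, e = false → TestDominates (nullComp n e) (altComp n σ B.card e)
          (batchLaw σ C B.card (∑ j ∈ B, clip C (g (D j))))
          (batchLaw σ C (B.card + 1) ((∑ j ∈ B, clip C (g (D j))) + clip C (g d))) := by
        rintro _ rfl
        exact h
      rw [show normFactor B = B.card from if_neg hB]
      exact key _ (decide_eq_false hB)

end LowerBound

end ASGM

end

theorem mainTheorem2 (n N : ℕ) (hn : 1 ≤ n) (q σ : ℝ) (hq0 : 0 ≤ q) (hq1 : q ≤ 1) (hσ : 0 < σ) :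
    ∃ f : ℝ → ℝ,
      ASGM.IsTradeOffFunction f ∧
      (∀ α ∈ Set.Icc (0 : ℝ) 1, ∃ t : ℝ≥0∞, ∃ c ∈ Set.Icc (0 : ℝ) 1,
        ASGM.lowerAlpha n N q σ t c = α) ∧
      (∀ t : ℝ≥0∞, ∀ c ∈ Set.Icc (0 : ℝ) 1,
        ASGM.lowerAlpha n N q σ t c ∈ Set.Icc (0 : ℝ) 1 ∧
        f (ASGM.lowerAlpha n N q σ t c) = ASGM.lowerValue n N q σ t c) ∧
      ∀ (X : Type*) (g : X → EuclideanSpace ℝ (Fin n)) (C : ℝ), 0 < C →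
        ∀ (D : Fin N → X) (d : X), ∀ α ∈ Set.Icc (0 : ℝ) 1,
          f α ≤ ASGM.tradeOff (ASGM.asgm g q σ C D)
            (ASGM.asgm g q σ C (Fin.snoc D d : Fin (N + 1) → X)) α := by
  have hw := ASGM.tagWeight_nonneg (N := N) hq0 hq1
  set P := ASGM.taggedMixture (ASGM.tagWeight q) (ASGM.compNull (N := N) n) with hP
  set Q := ASGM.taggedMixture (ASGM.tagWeight q) (ASGM.compAlt (N := N) n σ) with hQ
  have : IsProbabilityMeasure P :=
    ASGM.isProbabilityMeasure_taggedMixture hw (ASGM.sum_tagWeight N q) _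
  have : IsProbabilityMeasure Q :=
    ASGM.isProbabilityMeasure_taggedMixture hw (ASGM.sum_tagWeight N q) _
  set L : (Σ i : Finset (Fin N) × Bool, ASGM.CompSpace n (decide (i.1 = ∅))) → ℝ≥0∞ :=
    fun x => (ASGM.compAlt n σ x.1).rnDeriv (ASGM.compNull n x.1) x.2 with hL
  have hLm : Measurable L := ASGM.measurable_sigma_of_forall fun i =>
    Measure.measurable_rnDeriv (ASGM.compAlt n σ i) (ASGM.compNull n i)
  have hLQ : P.withDensity L = Q :=
    ASGM.taggedMixture_withDensity _ _ _ (ASGM.compAlt_absolutelyContinuous σ)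
  have : IsProbabilityMeasure (P.withDensity L) := by rwa [hLQ]
  have hα : ∀ t : ℝ≥0∞, ∀ c ∈ Set.Icc (0 : ℝ) 1,
      ∫ x, ASGM.lrt L t c x ∂P = ASGM.lowerAlpha n N q σ t c := by
    intro t c hc
    rw [ASGM.lowerAlpha_eq, hP,
      ASGM.integral_taggedMixture hw _ (ASGM.isRejectionRule_lrt hLm t hc)]
    refine Finset.sum_congr rfl fun i _ => ?_
    rw [← ASGM.integral_lrt_rnDeriv]
    rfl
  have hβ : ∀ t : ℝ≥0∞, ∀ c ∈ Set.Icc (0 : ℝ) 1,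
      ∫ x, (1 - ASGM.lrt L t c x) ∂Q = ASGM.lowerValue n N q σ t c := by
    intro t c hc
    have hr := ASGM.isRejectionRule_lrt hLm t hc
    rw [ASGM.lowerValue_eq q σ t hc, hQ, ASGM.integral_taggedMixture hw _
      ⟨hr.1.const_sub 1, fun x => ⟨sub_nonneg.2 (hr.2 x).2, sub_le_self _ (hr.2 x).1⟩⟩]
    rfl
  refine ⟨ASGM.tradeOff P Q, ⟨_, _, P, Q, inferInstance, inferInstance, fun _ _ => rfl⟩,
    fun α hα01 => ?_, fun t c hc => ⟨?_, ?_⟩, fun X g C hC D d α hα01 => ?_⟩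
  · obtain ⟨t, c, hc, h⟩ := ASGM.exists_integral_lrt_eq hLm P hα01
    exact ⟨t, c, hc, (hα t c hc).symm.trans h⟩
  · rw [← hα t c hc]
    have hr := ASGM.isRejectionRule_lrt hLm t hc
    exact ⟨hr.integral_nonneg P, hr.integral_le_one P⟩
  · rw [← hα t c hc, ← hβ t c hc, ← hLQ]
    exact ASGM.tradeOff_lrt hLm P t hc
  · rw [ASGM.asgm_eq_sum g hq0 hq1, ASGM.asgm_snoc_eq_sum]
    have hp : ∀ i : Finset (Fin N) × Bool, IsProbabilityMeasure (if i.2 then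
        ASGM.batchLaw σ C (i.1.card + 1) ((∑ j ∈ i.1, ASGM.clip C (g (D j))) + ASGM.clip C (g d))
        else ASGM.batchLaw σ C (ASGM.normFactor i.1) (∑ j ∈ i.1, ASGM.clip C (g (D j)))) := by
      intro i
      split_ifs <;> infer_instance
    have := ASGM.isProbabilityMeasure_sum_ofReal_smul hw (ASGM.sum_tagWeight N q)
      fun i : Finset (Fin N) × Bool => if i.2 then
        ASGM.batchLaw σ C (i.1.card + 1) ((∑ j ∈ i.1, ASGM.clip C (g (D j))) + ASGM.clip C (g d))
        else ASGM.batchLaw σ C (ASGM.normFactor i.1) (∑ j ∈ i.1, ASGM.clip C (g (D j)))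
    exact (ASGM.testDominates_taggedMixture hw _ _ _ _
      (ASGM.testDominates_comp hn hσ hC g D d)).tradeOff_le hα01.1
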